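/- **Theorem 1.** A *workflow net* is a tuple $(P,T,F,i,o)$ with disjoint finite sets $P$ (places) and $T$ (transitions), arcs $F\subseteq (P\times T)\cup(T\times P)$, and places $i,o$ such that $i$ has no incoming arcs, $o$ has no outgoing arcs, and the graph $(P\cup T, F\cup\{(o,i)\})$ is strongly connected. Write ${}^\bullet t$, $t^\bullet$ for the sets of input and output places of $t$. A marking is a function $M:P\to\mathbb N$; $M$ enables $t$ if $M\ge 1$ on ${}^\bullet t$, and firing $t$ then removes one token from each place of ${}^\bullet t$ and afterwards adds one to each place of $t^\bullet$. The initial (final) marking has one token on $i$ (on $o$) and none elsewhere; *reachable* means reachable from the initial marking. The net is *sound* if the final marking is reachable from every reachable marking, and *1-safe* if every reachable marking $M$ satisfies $M\le 1$; such an $M$ is identified with the set of its marked places. For $t$ enabled at $M$, the *conflict set* $C(t,M)$ is the set of transitions $u$ enabled at $M$ with ${}^\bullet t\cap{}^\bullet u\ne\emptyset$; the conflict sets of $M$ are the sets $C(t,M)$ with $t$ enabled at $M$. A 1-safe workflow net is *confusion-free* if for every reachable $M$ and all $t,u$ enabled at $M$ with ${}^\bullet t\cap{}^\bullet u=\emptyset$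 one has $C(u,M)=C(u,M\setminus{}^\bullet t)=C(u,(M\setminus{}^\bullet t)\cup t^\bullet)$, where $C(u,\cdot)=\emptyset$ if $u$ is not enabled. A *timed probabilistic workflow net* (TPWN) $\mathcal W$ is a 1-safe confusion-free workflow net with weights $w:T\to\mathbb Q_{>0}$ and durations $\tau:T\to\mathbb N$. For a transition sequence $\sigma$ define timestamps $\mu(\sigma)\in(\mathbb N\cup\{\bot\})^P$, where $\bot\le x$ and $\bot+x=\bot$, by $\mu(\epsilon)_i=0$, $\mu(\epsilon)_p=\bot$ for $p\ne i$, and $$\mu(\sigma t)_p=\begin{cases}\max_{q\in{}^\bullet t}\mu(\sigma)_q+\tau(t)& p\in t^\bullet\\ \bot& p\in{}^\bullet t\setminus t^\bullet\\ \mu(\sigma)_p&\text{otherwise,}\end{cases}$$ and put $\mathrm{time}(\sigma)=\max_{p\in P}\mu(\sigma)_p$. The Markov decision process of $\mathcal W$ has as states the reachable markings $M$ and the pairs $(M,t)$ with $M$ reachable and $t$ enabled at $M$; it starts in the initial marking. In a marking $M$ that enables no transition, it stays in $M$. In any other marking $M$ there is one available distribution for each conflict set $C$ of $M$: it moves to $(M,t)$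 with probability $w(t)/\sum_{u\in C}w(u)$ for $t\in C$. From $(M,t)$ it moves with probability $1$ to the marking obtained by firing $t$ at $M$. A scheduler $S$ maps every finite path to a distribution available in its last state, and so determines a probability measure $\mathrm{Prob}^S$ on infinite paths. The time needed to reach the final marking along an infinite path $\pi$ is $\mathrm{time}(\sigma)$, where $\sigma$ is the sequence of transitions fired along the shortest prefix of $\pi$ that ends in the final marking, and $\infty$ if $\pi$ never visits the final marking. Let $ET^S_{\mathcal W}\in[0,\infty]$ be the expectation of this time under $\mathrm{Prob}^S$. For every TPWN $\mathcal W$: 1. there is a value $ET_{\mathcal W}\in[0,\infty]$ such that $ET^S_{\mathcal W}=ET_{\mathcal W}$ for every scheduler $S$; 2. $ET_{\mathcal W}$ is finite if and only if $\mathcal W$ is sound. -/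

import Mathlib

open MeasureTheory ProbabilityTheory
open scoped ENNReal

/-! ### Petri nets and workflow nets -/

/-- A net with places `P` and transitions `T`: the arcs `F ⊆ (P × T) ∪ (T × P)` are given by
the preset and the postset of each transition; `i` and `o` are the initial and the final place. -/
structure Net (P T : Type*) where
  pre : T → Finset P
  post : T → Finset P
  i : P
  o : P

/-- Markings: the number of tokens in each place. -/
abbrev Marking (P : Type*) := P → ℕ

namespace Net

variable {P T : Type*} (N : Net P T)

/-- The arcs of the graph `(P ∪ T, F ∪ {(o, i)})`. -/
inductive ArcOrBack : P ⊕ T → P ⊕ T → Prop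
  | preArc (t : T) (p : P) (h : p ∈ N.pre t) : ArcOrBack (Sum.inl p) (Sum.inr t)
  | postArc (t : T) (p : P) (h : p ∈ N.post t) : ArcOrBack (Sum.inr t) (Sum.inl p)
  | back : ArcOrBack (Sum.inl N.o) (Sum.inl N.i)

/-- Workflow nets: `i` has no incoming arcs, `o` has no outgoing arcs, and the graph
`(P ∪ T, F ∪ {(o, i)})` is strongly connected. -/
structure IsWorkflow : Prop where
  noArcTo_i : ∀ t, N.i ∉ N.post t
  noArcFrom_o : ∀ t, N.o ∉ N.pre t
  stronglyConnected : ∀ x y : P ⊕ T, Relation.ReflTransGen N.ArcOrBack x y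

variable [DecidableEq P]

/-- The initial marking: one token on `i`, no token elsewhere. -/
def initial : Marking P := Pi.single N.i 1

/-- The final marking: one token on `o`, no token elsewhere. -/
def final : Marking P := Pi.single N.o 1

/-- `M` enables `t`. -/
def Enabled (M : Marking P) (t : T) : Prop := ∀ p ∈ N.pre t, 1 ≤ M p

instance (M : Marking P) (t : T) : Decidable (N.Enabled M t) :=
  inferInstanceAs (Decidable (∀ p ∈ N.pre t, 1 ≤ M p))

/-- The marking obtained by firing `t` at `M` (used only where `M` enables `t`). -/
def fire (M : Marking P) (t : T) : Marking P := fun p =>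
  if p ∈ N.pre t \ N.post t then M p - 1
  else if p ∈ N.post t \ N.pre t then M p + 1
  else M p

/-- `M —σ→ M'`: the sequence `σ` can be fired from `M` and leads to `M'`. -/
inductive FiringSeq : Marking P → List T → Marking P → Prop
  | nil (M : Marking P) : FiringSeq M [] M
  | cons (M : Marking P) (t : T) (σ : List T) (M' : Marking P) (ht : N.Enabled M t)
      (hσ : FiringSeq (N.fire M t) σ M') : FiringSeq M (t :: σ) M'

/-- `M` is reachable (from the initial marking). -/
def Reachable (M : Marking P) : Prop := ∃ σ, N.FiringSeq N.initial σ M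

/-- The final marking is reachable from every reachable marking. -/
def Sound : Prop := ∀ M, N.Reachable M → ∃ σ, N.FiringSeq M σ N.final

/-- Every reachable marking puts at most one token on every place. -/
def OneSafe : Prop := ∀ M, N.Reachable M → ∀ p, M p ≤ 1

/-- Two transitions are independent if their presets are disjoint. -/
def Independent (t u : T) : Prop := Disjoint (N.pre t) (N.pre u)

instance (t u : T) : Decidable (N.Independent t u) :=
  inferInstanceAs (Decidable (Disjoint (N.pre t) (N.pre u)))

/-- `t` and `u` are concurrent at `M`. -/
def Concurrent (M : Marking P) (t u : T) : Prop :=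
  N.Enabled M t ∧ N.Enabled M u ∧ N.Independent t u

/-- `t` and `u` are in conflict at `M`. -/
def InConflict (M : Marking P) (t u : T) : Prop :=
  N.Enabled M t ∧ N.Enabled M u ∧ ¬ N.Independent t u

instance (M : Marking P) (t u : T) : Decidable (N.InConflict M t u) :=
  inferInstanceAs (Decidable (_ ∧ _ ∧ _))

variable [Fintype P] [Fintype T]

/-- `C(t, M)`: the transitions in conflict with `t` at `M`. -/
def conflictSet (t : T) (M : Marking P) : Finset T :=
  Finset.univ.filter fun u => N.InConflict M t u

/-- The conflict sets of `M`: the sets `C(t, M)`, for the transitions `t` enabled at `M`. -/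
def conflictSets (M : Marking P) : Set (Finset T) :=
  {C | ∃ t, N.Enabled M t ∧ C = N.conflictSet t M}

/-- The set of places that carry a token; a 1-safe marking is identified with it. -/
def marked (M : Marking P) : Finset P := Finset.univ.filter fun p => 1 ≤ M p

/-- The 1-safe marking that corresponds to a set of places. -/
def ofPlaces (S : Finset P) : Marking P := fun p => if p ∈ S then 1 else 0

/-- Confusion-freeness: for every reachable `M` and all transitions `t`, `u` concurrent at `M`,
`C(u, M) = C(u, M \ •t) = C(u, (M \ •t) ∪ t•)`. -/
def ConfusionFree : Prop :=
  ∀ M, N.Reachable M → ∀ t u, N.Concurrent M t u →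
    N.conflictSet u M = N.conflictSet u (ofPlaces (marked M \ N.pre t)) ∧
    N.conflictSet u M = N.conflictSet u (ofPlaces ((marked M \ N.pre t) ∪ N.post t))

end Net

/-- A timed probabilistic workflow net: a 1-safe confusion-free workflow net with positive
rational weights and natural-number durations. -/
structure TPWN (P T : Type*) [Fintype P] [DecidableEq P] [Fintype T] extends Net P T where
  isWorkflow : toNet.IsWorkflow
  oneSafe : toNet.OneSafe
  confusionFree : toNet.ConfusionFree
  weight : T → ℚ
  weight_pos : ∀ t, 0 < weight t
  dur : T → ℕ

/-! ### Markov decision processes -/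

/-- A Markov decision process with state set `Q`. -/
structure MDP (Q : Type*) where
  init : Q
  steps : Q → Set (PMF Q)
  steps_nonempty : ∀ q, (steps q).Nonempty

namespace MDP

variable {Q : Type*} (D : MDP Q)

/-- A (deterministic, history-dependent) scheduler: it maps every finite path
`π(0), …, π(n)` to one of the distributions available in its last state. The distributions chosen
earlier need not be recorded in a path: they are determined by the scheduler and the states. -/
structure Scheduler where
  choose : (n : ℕ) → (Finset.Iic n → Q) → PMF Q
  choose_mem : ∀ n π, choose n π ∈ D.steps (π ⟨n, Finset.mem_Iic.2 le_rfl⟩)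

instance : Nonempty D.Scheduler :=
  ⟨⟨fun n π => (D.steps_nonempty (π ⟨n, Finset.mem_Iic.2 le_rfl⟩)).choose,
    fun _ _ => (D.steps_nonempty _).choose_spec⟩⟩

variable {D} [Finite Q] [MeasurableSpace Q] [MeasurableSingletonClass Q]

/-- The law of the next state under a scheduler, given the path up to time `n`. -/
noncomputable def Scheduler.kernel (S : D.Scheduler) (n : ℕ) :
    Kernel (Finset.Iic n → Q) Q :=
  Kernel.ofFunOfCountable fun π => (S.choose n π).toMeasure

instance (S : D.Scheduler) (n : ℕ) : IsMarkovKernel (S.kernel n) :=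
  ⟨fun π => inferInstanceAs (IsProbabilityMeasure (S.choose n π).toMeasure)⟩

/-- `Prob^S`: the probability measure on infinite paths that starts in the initial state and
whose transition probabilities are those chosen by `S`. -/
noncomputable def Scheduler.prob (S : D.Scheduler) : Measure (ℕ → Q) :=
  Kernel.traj (X := fun _ => Q) S.kernel 0 (fun _ => D.init)

end MDP

/-! ### Timed sequences and the MDP semantics -/

namespace TPWN

variable {P T : Type*} [Fintype P] [DecidableEq P] [Fintype T] (W : TPWN P T)

/-- The update of a timestamp vector (with values in `ℕ ∪ {⊥}`) by a transition. -/
def upd (x : P → WithBot ℕ) (t : T) : P → WithBot ℕ := fun p =>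
  if p ∈ W.post t then (W.pre t).sup x + (W.dur t : WithBot ℕ)
  else if p ∈ W.pre t then ⊥
  else x p

/-- The timestamps `μ(σ)` after a transition sequence `σ`. -/
def timestamp (σ : List T) : P → WithBot ℕ :=
  σ.foldl W.upd fun p => if p = W.i then 0 else ⊥

/-- `time(σ)`, the maximum of the timestamps after `σ`. -/
def time (σ : List T) : WithBot ℕ := Finset.univ.sup (W.timestamp σ)

/-- The states of the MDP: reachable markings `M`, and pairs `(M, t)` of a reachable marking and a
transition `t` enabled at it. -/
inductive State
  | marking (M : Marking P) (hM : W.Reachable M)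
  | selected (M : Marking P) (hM : W.Reachable M) (t : T) (ht : W.Enabled M t)

instance : MeasurableSpace W.State := ⊤

instance : DiscreteMeasurableSpace W.State := ⟨fun _ => trivial⟩

instance : Finite W.State := by
  classical
  have key : ∀ M M' : Marking P, W.Reachable M → W.Reachable M' →
      Net.marked M = Net.marked M' → M = M' := by
    intro M M' hM hM' h
    funext p
    have h1 := W.oneSafe M hM p
    have h2 := W.oneSafe M' hM' p
    have h3 : p ∈ Net.marked M ↔ p ∈ Net.marked M' := by rw [h]
    simp only [Net.marked, Finset.mem_filter, Finset.mem_univ, true_and] at h3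
    omega
  let f : W.State → Finset P × Option T := fun q =>
    match q with
    | .marking M _ => (Net.marked M, none)
    | .selected M _ t _ => (Net.marked M, some t)
  refine Finite.of_injective f ?_
  rintro (⟨M, hM⟩ | ⟨M, hM, t, ht⟩) (⟨M', hM'⟩ | ⟨M', hM', t', ht'⟩) h
  · obtain rfl := key M M' hM hM' (by simpa [f] using h)
    rfl
  · simp [f] at h
  · simp [f] at h
  · obtain ⟨h1, rfl⟩ : Net.marked M = Net.marked M' ∧ t = t' := by simpa [f] using h
    obtain rfl := key M M' hM hM' h1
    rfl

theorem reachable_initial : W.Reachable W.initial := ⟨[], .nil _⟩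

theorem reachable_fire {M : Marking P} (hM : W.Reachable M) {t : T} (ht : W.Enabled M t) :
    W.Reachable (W.fire M t) := by
  obtain ⟨σ, hσ⟩ := hM
  refine ⟨σ ++ [t], ?_⟩
  generalize W.initial = M₀ at hσ
  induction hσ with
  | nil M => exact .cons _ _ _ _ ht (.nil _)
  | cons M u σ M' hu _ ih => exact .cons _ _ _ _ hu (ih ht)

theorem pre_nonempty (t : T) : (W.pre t).Nonempty := by
  rcases (W.isWorkflow.stronglyConnected (Sum.inl W.i) (Sum.inr t)).cases_tail with h | ⟨c, _, h⟩
  · cases h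
  · cases h with
    | preArc _ p hp => exact ⟨p, hp⟩

variable [DecidableEq T]

/-- The probability of the transition `t` when the conflict set `C` is chosen:
`w(t) / w(C)` if `t ∈ C`, and `0` otherwise. -/
noncomputable def choiceProb (C : Finset T) (t : T) : ℝ≥0∞ :=
  if t ∈ C then ENNReal.ofReal ((W.weight t / ∑ u ∈ C, W.weight u : ℚ) : ℝ) else 0

/-- The probability of moving to a state from the marking `M` when the conflict set `C` is
chosen: `w(t) / w(C)` for the state `(M, t)` with `t ∈ C`, and `0` for every other state. -/
noncomputable def stepProb (M : Marking P) (C : Finset T) : W.State → ℝ≥0∞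
  | .marking _ _ => 0
  | .selected M' _ t _ => if M' = M then W.choiceProb C t else 0

/-- The distributions available in a state: in a marking that enables no transition, to stay
there; in any other marking, one distribution for each conflict set; in a pair `(M, t)`, to move
to the marking obtained by firing `t`. -/
noncomputable def steps : W.State → Set (PMF W.State)
  | .marking M hM =>
      {l | (∀ t, ¬ W.Enabled M t) ∧ l = PMF.pure (.marking M hM)} ∪
      {l | ∃ C ∈ W.conflictSets M, ∀ s, l s = W.stepProb M C s}
  | .selected M hM t ht => {PMF.pure (.marking (W.fire M t) (W.reachable_fire hM ht))}

theorem steps_nonempty (q : W.State) : (W.steps q).Nonempty := by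
  classical
  rcases q with ⟨M, hM⟩ | ⟨M, hM, t, ht⟩
  · by_cases h : ∃ t, W.Enabled M t
    · obtain ⟨t, ht⟩ := h
      set C := W.conflictSet t M with hC
      have hmem : ∀ u, u ∈ C → W.Enabled M u := fun u hu => by
        simp only [hC, Net.conflictSet, Finset.mem_filter] at hu
        exact hu.2.2.1
      have htC : t ∈ C := by
        simp only [hC, Net.conflictSet, Finset.mem_filter, Finset.mem_univ, true_and]
        exact ⟨ht, ht, fun h => (W.pre_nonempty t).ne_empty (Finset.disjoint_self_iff_empty _ |>.1 h)⟩
      have hpos : 0 < ∑ u ∈ C, W.weight u := Finset.sum_pos (fun u _ => W.weight_pos u) ⟨t, htC⟩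
      have hsum : ∑ u, W.choiceProb C u = 1 := by
        simp only [choiceProb]
        rw [Finset.sum_ite_mem, Finset.univ_inter, ← ENNReal.ofReal_sum_of_nonneg, ← Rat.cast_sum,
          ← Finset.sum_div, div_self hpos.ne']
        · simp
        · intro u _
          exact_mod_cast (div_pos (W.weight_pos u) hpos).le
      let p : PMF T := PMF.ofFintype (W.choiceProb C) hsum
      let g : T → W.State := fun u =>
        if hu : W.Enabled M u then .selected M hM u hu else .marking M hM
      refine ⟨p.map g, Or.inr ⟨C, ⟨t, ht, hC⟩, fun s => ?_⟩⟩
      rw [PMF.map_apply, tsum_fintype]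
      have hp : ∀ u, p u = W.choiceProb C u := fun u => rfl
      have hz : ∀ u, u ∉ C → p u = 0 := fun u hu => by rw [hp, choiceProb, if_neg hu]
      rcases s with ⟨M', hM'⟩ | ⟨M', hM', u, hu⟩
      · refine Finset.sum_eq_zero fun v _ => ?_
        by_cases hv : v ∈ C
        · simp [g, hmem v hv]
        · simp [hz v hv]
      · simp only [stepProb]
        split_ifs with hMM
        · subst hMM
          rw [Finset.sum_eq_single u]
          · simp [g, hu, hp]
          · intro v _ hvu
            rw [if_neg]
            intro h
            simp only [g] at h
            split_ifs at h with hv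
            injection h with _ h2
            exact hvu h2.symm
          · simp
        · refine Finset.sum_eq_zero fun v _ => ?_
          rw [if_neg]
          intro h
          simp only [g] at h
          split_ifs at h with hv
          injection h with h1
          exact hMM h1
    · push Not at h
      exact ⟨_, Or.inl ⟨h, rfl⟩⟩
  · exact ⟨_, rfl⟩

/-- The Markov decision process that is the semantics of `W`. -/
noncomputable def mdp : MDP W.State where
  init := .marking W.initial W.reachable_initial
  steps := W.steps
  steps_nonempty := W.steps_nonempty

/-- The state is the marking `M`. -/
def State.IsMarking {W : TPWN P T} (M : Marking P) : W.State → Prop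
  | .marking M' _ => M' = M
  | .selected _ _ _ _ => False

/-- The transition selected in a state, if there is one. -/
def State.transition? {W : TPWN P T} : W.State → Option T
  | .marking _ _ => none
  | .selected _ _ t _ => some t

/-- The transition sequence of the prefix `π(0), …, π(n)` of a path. -/
def pathSeq (π : ℕ → W.State) (n : ℕ) : List T :=
  (List.range (n + 1)).filterMap fun k => (π k).transition?

open Classical in
/-- The time needed to reach the marking `M` along the infinite path `π`: the time of the
transition sequence of the shortest prefix of `π` that ends at `M`, and `∞` if `π` does not
visit `M`. (For a path that starts in the initial marking and respects the MDP, `time` is never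
`⊥`, so the value of `unbotD` at `⊥` plays no role.) -/
noncomputable def timeTo (M : Marking P) (π : ℕ → W.State) : ℝ≥0∞ :=
  if h : ∃ n, (π n).IsMarking M then
    (((W.time (W.pathSeq π (Nat.find h))).unbotD 0 : ℕ) : ℝ≥0∞)
  else ∞

/-- The expected time until reaching the marking `M` under the scheduler `S`. -/
noncomputable def expectedTimeTo (S : W.mdp.Scheduler) (M : Marking P) : ℝ≥0∞ :=
  ∫⁻ π, W.timeTo M π ∂S.prob

/-- The expected time of `W` under `S`: the expected time until reaching the final marking. -/
noncomputable def expectedTime (S : W.mdp.Scheduler) : ℝ≥0∞ := W.expectedTimeTo S W.final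

end TPWN

/-!
Two different conflict sets of a reachable marking are concurrent: confusion-freeness makes
conflict transitive (`TPWN.inConflict_trans`), a transition outside a conflict set leaves that set
untouched (`TPWN.conflictSets_fire`), and by 1-safety concurrent transitions commute on markings and
on timestamps (`TPWN.fire_comm`, `TPWN.upd_comm`). So a scheduler decides only the order in which
conflict sets are resolved, and this order affects neither the probabilities nor the timestamps.

This is made precise without equivalence classes of runs. For a function `g` of the timestamps,
`TPWN.value g n M x` is the expectation of `g` on arrival in the final marking within `n`
transitions, defined by a recursion that resolves an arbitrary conflict set. An induction on `n`
shows that the recursion holds for every conflict set (`TPWN.value_succ`): two different ones can be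
swapped. No run can end while a conflict set is still open, because the final marking enables no
transition, so nothing is lost at the horizon. Hence, along the paths of any scheduler, the value of
the current state over the remaining horizon has a constant expectation
(`TPWN.lintegral_stateValue`). In the limit, for every scheduler, the expected time is
`sup_n value(time) + ∞ * (1 - sup_n value(1))` (`TPWN.expectedTime_eq_limitTime`).

Since that expression does not mention a scheduler, finiteness can be decided by following
favourable conflict sets. In a sound net, always heading for the final marking along a shortest
firing sequence gives a function of the marking that decreases by at least `1` on average with each
transition (`TPWN.exists_isDrift`). It bounds the expected number of transitions, hence the expected
time, and forces arrival almost surely. In an unsound net, heading for a marking from which the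
final one is unreachable misses the final marking with positive probability (`TPWN.exists_gap`).
-/

namespace TPWN

variable {P T : Type*} [Fintype P] [DecidableEq P] [Fintype T] (W : TPWN P T)

/-! ### Conflict sets and concurrent transitions -/

theorem mem_conflictSet {M : Marking P} {t u : T} :
    u ∈ W.conflictSet t M ↔ W.InConflict M t u := by
  simp [Net.conflictSet]

theorem inConflict_self {M : Marking P} {t : T} (ht : W.Enabled M t) : W.InConflict M t t :=
  ⟨ht, ht, fun h => (W.pre_nonempty t).ne_empty (Finset.disjoint_self_iff_empty _ |>.1 h)⟩

theorem inConflict_symm {M : Marking P} {t u : T} (h : W.InConflict M t u) :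
    W.InConflict M u t :=
  ⟨h.2.1, h.1, fun h' => h.2.2 (Disjoint.symm h')⟩

theorem fire_eq_ofPlaces {M : Marking P} (hM : W.Reachable M) {t : T} (ht : W.Enabled M t) :
    W.fire M t = Net.ofPlaces ((Net.marked M \ W.pre t) ∪ W.post t) := by
  funext p
  have h1 := W.oneSafe M hM p
  have h2 := W.oneSafe _ (W.reachable_fire hM ht) p
  have h3 := ht p
  simp only [Net.fire, Net.ofPlaces, Net.marked, Finset.mem_sdiff, Finset.mem_union,
    Finset.mem_filter, Finset.mem_univ, true_and] at h2 ⊢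
  by_cases hp : p ∈ W.pre t <;> by_cases hq : p ∈ W.post t <;> simp_all <;>
    first | omega | (split_ifs <;> omega)

/-- Confusion-freeness makes conflict transitive: if `t` and `v` were concurrent, firing `t`
would remove `u` from the conflict set of `v`. -/
theorem inConflict_trans {M : Marking P} (hM : W.Reachable M) {t u v : T}
    (h₁ : W.InConflict M t u) (h₂ : W.InConflict M u v) : W.InConflict M t v := by
  refine ⟨h₁.1, h₂.2.1, fun hind => ?_⟩
  have h := (W.confusionFree M hM t v ⟨h₁.1, h₂.2.1, hind⟩).1
  have hu : u ∈ W.conflictSet v M := W.mem_conflictSet.2 (W.inConflict_symm h₂)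
  rw [h, mem_conflictSet] at hu
  obtain ⟨p, hpt, hpu⟩ := Finset.not_disjoint_iff.1 h₁.2.2
  have := hu.2.1 p hpu
  simp [Net.ofPlaces, hpt] at this

theorem conflictSet_eq_of_mem {M : Marking P} (hM : W.Reachable M) {t u : T}
    (h : u ∈ W.conflictSet t M) : W.conflictSet u M = W.conflictSet t M := by
  rw [mem_conflictSet] at h
  ext v
  simp only [mem_conflictSet]
  exact ⟨fun h' => W.inConflict_trans hM h h',
    fun h' => W.inConflict_trans hM (W.inConflict_symm h) h'⟩

theorem eq_conflictSet_of_mem {M : Marking P} (hM : W.Reachable M) {C : Finset T}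
    (hC : C ∈ W.conflictSets M) {t : T} (ht : t ∈ C) : C = W.conflictSet t M := by
  obtain ⟨u, _, rfl⟩ := hC
  exact (W.conflictSet_eq_of_mem hM ht).symm

theorem enabled_of_mem_conflictSets {M : Marking P} {C : Finset T}
    (hC : C ∈ W.conflictSets M) {t : T} (ht : t ∈ C) : W.Enabled M t := by
  obtain ⟨u, _, rfl⟩ := hC
  exact (W.mem_conflictSet.1 ht).2.1

theorem nonempty_of_mem_conflictSets {M : Marking P} {C : Finset T}
    (hC : C ∈ W.conflictSets M) : C.Nonempty := by
  obtain ⟨u, hu, rfl⟩ := hC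
  exact ⟨u, W.mem_conflictSet.2 (W.inConflict_self hu)⟩

theorem conflictSet_mem_conflictSets {M : Marking P} {t : T} (ht : W.Enabled M t) :
    W.conflictSet t M ∈ W.conflictSets M :=
  ⟨t, ht, rfl⟩

theorem concurrent_of_ne {M : Marking P} (hM : W.Reachable M) {C D : Finset T}
    (hC : C ∈ W.conflictSets M) (hD : D ∈ W.conflictSets M) (hne : C ≠ D) {t u : T}
    (ht : t ∈ C) (hu : u ∈ D) : W.Concurrent M t u := by
  have ht' := W.enabled_of_mem_conflictSets hC ht
  have hu' := W.enabled_of_mem_conflictSets hD hu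
  refine ⟨ht', hu', by_contra fun hind => hne ?_⟩
  rw [W.eq_conflictSet_of_mem hM hC ht, W.eq_conflictSet_of_mem hM hD hu]
  exact (W.conflictSet_eq_of_mem hM (W.mem_conflictSet.2 ⟨ht', hu', hind⟩)).symm

theorem concurrent_symm {M : Marking P} {t u : T} (h : W.Concurrent M t u) :
    W.Concurrent M u t :=
  ⟨h.2.1, h.1, Disjoint.symm h.2.2⟩

theorem conflictSet_fire {M : Marking P} (hM : W.Reachable M) {t u : T}
    (h : W.Concurrent M t u) : W.conflictSet u (W.fire M t) = W.conflictSet u M := by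
  rw [W.fire_eq_ofPlaces hM h.1]
  exact (W.confusionFree M hM t u h).2.symm

theorem enabled_fire {M : Marking P} (hM : W.Reachable M) {t u : T}
    (h : W.Concurrent M t u) : W.Enabled (W.fire M t) u := by
  have hu : u ∈ W.conflictSet u M := W.mem_conflictSet.2 (W.inConflict_self h.2.1)
  rw [← W.conflictSet_fire hM h] at hu
  exact (W.mem_conflictSet.1 hu).1

/-- A conflict set survives the firing of a transition outside it. -/
theorem conflictSets_fire {M : Marking P} (hM : W.Reachable M) {C D : Finset T}
    (hC : C ∈ W.conflictSets M) (hD : D ∈ W.conflictSets M) (hne : C ≠ D) {t : T}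
    (ht : t ∈ C) : D ∈ W.conflictSets (W.fire M t) := by
  obtain ⟨u, hu⟩ := W.nonempty_of_mem_conflictSets hD
  have h := W.concurrent_of_ne hM hC hD hne ht hu
  exact ⟨u, W.enabled_fire hM h,
    (W.eq_conflictSet_of_mem hM hD hu).trans (W.conflictSet_fire hM h).symm⟩

/-- Otherwise firing `u` would put a second token on a place of the preset of `t`. -/
theorem disjoint_pre_post_of_concurrent {M : Marking P} (hM : W.Reachable M) {t u : T}
    (h : W.Concurrent M t u) : Disjoint (W.pre t) (W.post u) := by
  refine Finset.disjoint_left.2 fun p hp hq => ?_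
  have h1 := h.1 p hp
  have h2 := W.oneSafe _ (W.reachable_fire hM h.2.1) p
  have h3 : p ∉ W.pre u := Finset.disjoint_left.1 h.2.2 hp
  simp [Net.fire, h3, hq] at h2
  omega

/-- Otherwise firing `t` and then `u` would put two tokens on a common output place. -/
theorem disjoint_post_of_concurrent {M : Marking P} (hM : W.Reachable M) {t u : T}
    (h : W.Concurrent M t u) : Disjoint (W.post t) (W.post u) := by
  refine Finset.disjoint_left.2 fun p hp hq => ?_
  have h2 := W.oneSafe _ (W.reachable_fire (W.reachable_fire hM h.1) (W.enabled_fire hM h)) p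
  have h3 : p ∉ W.pre t :=
    fun h' => Finset.disjoint_left.1 (W.disjoint_pre_post_of_concurrent hM h) h' hq
  have h4 : p ∉ W.pre u := fun h' =>
    Finset.disjoint_left.1 (W.disjoint_pre_post_of_concurrent hM (W.concurrent_symm h)) h' hp
  simp [Net.fire, h3, h4, hp, hq] at h2

theorem fire_comm {M : Marking P} (hM : W.Reachable M) {t u : T} (h : W.Concurrent M t u) :
    W.fire (W.fire M t) u = W.fire (W.fire M u) t := by
  have h1 := Finset.disjoint_left.1 h.2.2
  have h2 := Finset.disjoint_left.1 (W.disjoint_pre_post_of_concurrent hM h)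
  have h3 := Finset.disjoint_left.1 (W.disjoint_pre_post_of_concurrent hM (W.concurrent_symm h))
  have h4 := Finset.disjoint_left.1 (W.disjoint_post_of_concurrent hM h)
  funext p
  have h1 := @h1 p
  have h2 := @h2 p
  have h3 := @h3 p
  have h4 := @h4 p
  simp only [Net.fire, Finset.mem_sdiff]
  by_cases a : p ∈ W.pre t <;> by_cases b : p ∈ W.post t <;>
    by_cases c : p ∈ W.pre u <;> by_cases d : p ∈ W.post u <;> simp_all

theorem upd_comm {M : Marking P} (hM : W.Reachable M) {t u : T} (h : W.Concurrent M t u)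
    (x : P → WithBot ℕ) : W.upd (W.upd x t) u = W.upd (W.upd x u) t := by
  have h1 := Finset.disjoint_left.1 h.2.2
  have h2 := Finset.disjoint_left.1 (W.disjoint_pre_post_of_concurrent hM h)
  have h3 := Finset.disjoint_left.1 (W.disjoint_pre_post_of_concurrent hM (W.concurrent_symm h))
  have h4 := Finset.disjoint_left.1 (W.disjoint_post_of_concurrent hM h)
  have hu : (W.pre u).sup (W.upd x t) = (W.pre u).sup x :=
    Finset.sup_congr rfl fun p hp => by
      rw [upd, if_neg (h3 hp), if_neg fun h' => h1 h' hp]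
  have ht : (W.pre t).sup (W.upd x u) = (W.pre t).sup x :=
    Finset.sup_congr rfl fun p hp => by
      rw [upd, if_neg (h2 hp), if_neg (h1 hp)]
  funext p
  have h1 := @h1 p
  have h2 := @h2 p
  have h3 := @h3 p
  have h4 := @h4 p
  rw [upd, hu, upd, upd, ht, upd]
  by_cases a : p ∈ W.pre t <;> by_cases b : p ∈ W.post t <;>
    by_cases c : p ∈ W.pre u <;> by_cases d : p ∈ W.post u <;> simp_all

theorem not_enabled_final (t : T) : ¬ W.Enabled W.final t := by
  intro h
  obtain ⟨p, hp⟩ := W.pre_nonempty t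
  have h1 := h p hp
  have h2 : p ≠ W.o := fun h' => W.isWorkflow.noArcFrom_o t (h' ▸ hp)
  simp [Net.final, h2] at h1

theorem ne_final_of_enabled {M : Marking P} {t : T} (ht : W.Enabled M t) : M ≠ W.final :=
  fun h => W.not_enabled_final t (h ▸ ht)

/-! ### Timestamps along paths -/

/-- The timestamps after entering the state `s`: a transition takes effect when it is selected,
as it does in `pathSeq`. -/
def updState (x : P → WithBot ℕ) (s : W.State) : P → WithBot ℕ :=
  s.transition?.toList.foldl W.upd x

/-- The maximum of a timestamp vector, as an extended nonnegative real. The value at `⊥` is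
immaterial, as in `timeTo`. -/
noncomputable def maxTime (x : P → WithBot ℕ) : ℝ≥0∞ :=
  (((Finset.univ.sup x).unbotD 0 : ℕ) : ℝ≥0∞)

theorem pathSeq_congr {π π' : ℕ → W.State} {n : ℕ} (h : ∀ k ≤ n, π k = π' k) :
    W.pathSeq π n = W.pathSeq π' n := by
  refine List.filterMap_congr fun k hk => ?_
  rw [h k (Nat.lt_succ_iff.1 (List.mem_range.1 hk))]

theorem pathSeq_succ (π : ℕ → W.State) (n : ℕ) :
    W.pathSeq π (n + 1) = W.pathSeq π n ++ (π (n + 1)).transition?.toList := by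
  rw [pathSeq, List.range_succ, List.filterMap_append, pathSeq]
  congr 1

theorem timestamp_pathSeq_succ (π : ℕ → W.State) (n : ℕ) :
    W.timestamp (W.pathSeq π (n + 1)) =
      W.updState (W.timestamp (W.pathSeq π n)) (π (n + 1)) := by
  rw [pathSeq_succ, timestamp, List.foldl_append, updState, timestamp]

/-- An infinite path that continues a finite one. -/
def extendPath {n : ℕ} (h : Finset.Iic n → W.State) : ℕ → W.State := fun k =>
  if hk : k ≤ n then h ⟨k, Finset.mem_Iic.2 hk⟩ else h ⟨n, Finset.mem_Iic.2 le_rfl⟩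

theorem pathSeq_extendPath (π : ℕ → W.State) (n : ℕ) :
    W.pathSeq (W.extendPath (Preorder.frestrictLe (π := fun _ => W.State) n π)) n =
      W.pathSeq π n :=
  W.pathSeq_congr fun k hk => by simp [extendPath, hk]

theorem pathSeq_of_final_absorbing {π : ℕ → W.State}
    (hπ : ∀ k, (π k).IsMarking W.final → π (k + 1) = π k) {m n : ℕ} (hmn : m ≤ n)
    (hm : (π m).IsMarking W.final) :
    (π n).IsMarking W.final ∧ W.pathSeq π n = W.pathSeq π m := by
  induction n, hmn using Nat.le_induction with
  | base => exact ⟨hm, rfl⟩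
  | succ n _ ih =>
    have h : (π (n + 1)).IsMarking W.final := (hπ n ih.1).symm ▸ ih.1
    refine ⟨h, ?_⟩
    rw [pathSeq_succ, ih.2]
    rcases hq : π (n + 1) with ⟨M, hM⟩ | ⟨M, hM, t, ht⟩
    · simp [State.transition?]
    · rw [hq] at h
      exact h.elim

variable [DecidableEq T]

/-! ### The probabilities of a choice -/

theorem choiceProb_of_notMem {C : Finset T} {t : T} (ht : t ∉ C) : W.choiceProb C t = 0 := by
  rw [choiceProb, if_neg ht]

theorem choiceProb_ne_zero {C : Finset T} {t : T} (ht : t ∈ C) : W.choiceProb C t ≠ 0 := by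
  rw [choiceProb, if_pos ht]
  have hpos : 0 < ∑ u ∈ C, W.weight u := Finset.sum_pos (fun u _ => W.weight_pos u) ⟨t, ht⟩
  rw [Ne, ENNReal.ofReal_eq_zero, not_le]
  exact_mod_cast div_pos (W.weight_pos t) hpos

theorem sum_choiceProb {C : Finset T} (hC : C.Nonempty) : ∑ t, W.choiceProb C t = 1 := by
  have hpos : 0 < ∑ u ∈ C, W.weight u := Finset.sum_pos (fun u _ => W.weight_pos u) hC
  simp only [choiceProb]
  rw [Finset.sum_ite_mem, Finset.univ_inter, ← ENNReal.ofReal_sum_of_nonneg, ← Rat.cast_sum,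
    ← Finset.sum_div, div_self hpos.ne']
  · simp
  · intro u _
    exact_mod_cast (div_pos (W.weight_pos u) hpos).le

theorem sum_choiceProb_mul_le {C : Finset T} {a b : T → ℝ≥0∞} (h : ∀ t ∈ C, a t ≤ b t) :
    ∑ t, W.choiceProb C t * a t ≤ ∑ t, W.choiceProb C t * b t := by
  refine Finset.sum_le_sum fun t _ => ?_
  by_cases ht : t ∈ C
  · gcongr
    exact h t ht
  · simp [W.choiceProb_of_notMem ht]

theorem sum_choiceProb_mul_const {C : Finset T} (hC : C.Nonempty) (a : ℝ≥0∞) :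
    ∑ t, W.choiceProb C t * a = a := by
  rw [← Finset.sum_mul, W.sum_choiceProb hC, one_mul]

/-! ### The value of a marking does not depend on the order of the choices -/

/-- The expectation of `g` at the timestamps on arrival in the final marking, where only runs of
at most `n` transitions count, for a process that starts in `M` with timestamps `x` and always
resolves one particular conflict set, chosen arbitrarily. -/
noncomputable def value (g : (P → WithBot ℕ) → ℝ≥0∞) :
    ℕ → Marking P → (P → WithBot ℕ) → ℝ≥0∞
  | 0, M, x => if M = W.final then g x else 0
  | n + 1, M, x =>
    open Classical in
    if h : ∃ t, W.Enabled M t then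
      ∑ t, W.choiceProb (W.conflictSet h.choose M) t * value g n (W.fire M t) (W.upd x t)
    else value g n M x

variable (g : (P → WithBot ℕ) → ℝ≥0∞)

theorem value_zero (M : Marking P) (x : P → WithBot ℕ) :
    W.value g 0 M x = if M = W.final then g x else 0 := rfl

theorem value_of_deadlock {M : Marking P} (hM : ∀ t, ¬ W.Enabled M t) (n : ℕ)
    (x : P → WithBot ℕ) : W.value g n M x = if M = W.final then g x else 0 := by
  induction n with
  | zero => rfl
  | succ n ih => rw [value, dif_neg (by simpa using hM), ih]

theorem value_final (n : ℕ) (x : P → WithBot ℕ) : W.value g n W.final x = g x := by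
  rw [W.value_of_deadlock g W.not_enabled_final, if_pos rfl]

/-- The recursion for `value` holds for every conflict set. Two different conflict sets at `M` can
be resolved in either order, with the same probabilities and the same effect. -/
theorem value_succ {M : Marking P} (hM : W.Reachable M) {C : Finset T}
    (hC : C ∈ W.conflictSets M) (n : ℕ) (x : P → WithBot ℕ) :
    W.value g (n + 1) M x =
      ∑ t, W.choiceProb C t * W.value g n (W.fire M t) (W.upd x t) := by
  have hex : ∃ t, W.Enabled M t :=
    let ⟨t, ht⟩ := W.nonempty_of_mem_conflictSets hC
    ⟨t, W.enabled_of_mem_conflictSets hC ht⟩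
  rw [value, dif_pos hex]
  set D := W.conflictSet hex.choose M with hDdef
  have hD : D ∈ W.conflictSets M := ⟨_, hex.choose_spec, hDdef⟩
  clear_value D
  rcases eq_or_ne D C with rfl | hne
  · rfl
  induction n generalizing M x C D with
  | zero =>
    -- Both sums vanish: after one choice the other conflict set is still open, so the marking is
    -- not final.
    have key : ∀ {C D : Finset T}, C ∈ W.conflictSets M → D ∈ W.conflictSets M → C ≠ D →
        ∑ t, W.choiceProb C t * W.value g 0 (W.fire M t) (W.upd x t) = 0 := by
      intro C D hC hD hne
      refine Finset.sum_eq_zero fun t _ => ?_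
      by_cases ht : t ∈ C
      · have hD' := W.conflictSets_fire hM hC hD hne ht
        obtain ⟨u, hu⟩ := W.nonempty_of_mem_conflictSets hD'
        rw [value_zero, if_neg
          (W.ne_final_of_enabled (W.enabled_of_mem_conflictSets hD' hu)), mul_zero]
      · rw [W.choiceProb_of_notMem ht, zero_mul]
    rw [key hC hD hne.symm, key hD hC hne]
  | succ n ih =>
    -- By induction, the conflict set that was passed over may be resolved next.
    have key : ∀ {C D : Finset T}, C ∈ W.conflictSets M → D ∈ W.conflictSets M → C ≠ D →
        ∑ t, W.choiceProb C t * W.value g (n + 1) (W.fire M t) (W.upd x t) =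
          ∑ t, ∑ u, W.choiceProb C t * (W.choiceProb D u *
            W.value g n (W.fire (W.fire M t) u) (W.upd (W.upd x t) u)) := by
      intro C D hC hD hne
      refine Finset.sum_congr rfl fun t _ => ?_
      by_cases ht : t ∈ C
      · have hR := W.reachable_fire hM (W.enabled_of_mem_conflictSets hC ht)
        have hD' := W.conflictSets_fire hM hC hD hne ht
        have hex : ∃ t', W.Enabled (W.fire M t) t' :=
          let ⟨u, hu⟩ := W.nonempty_of_mem_conflictSets hD'
          ⟨u, W.enabled_of_mem_conflictSets hD' hu⟩
        rw [← Finset.mul_sum, value, dif_pos hex]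
        congr 1
        set E := W.conflictSet hex.choose (W.fire M t) with hEdef
        have hE : E ∈ W.conflictSets (W.fire M t) := ⟨_, hex.choose_spec, hEdef⟩
        clear_value E
        rcases eq_or_ne E D with rfl | hne'
        · rfl
        · exact ih hR hD' _ hex E hEdef hE hne'
      · simp [W.choiceProb_of_notMem ht]
    rw [key hC hD hne.symm, key hD hC hne, Finset.sum_comm]
    refine Finset.sum_congr rfl fun t _ => Finset.sum_congr rfl fun u _ => ?_
    by_cases ht : t ∈ C
    · by_cases hu : u ∈ D
      · have h := W.concurrent_of_ne hM hC hD hne.symm ht hu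
        rw [W.fire_comm hM h, W.upd_comm hM h]
        ring
      · simp [W.choiceProb_of_notMem hu]
    · simp [W.choiceProb_of_notMem ht]

/-! ### The value of a state of the decision process -/

/-- The expectation of `g` at the timestamps `m` steps later, on the event that the final marking
has then been reached, for a process that is now in a given state with timestamps `x`. -/
noncomputable def stateValue : ℕ → W.State → (P → WithBot ℕ) → ℝ≥0∞
  | m, .marking M _, x => W.value g (m / 2) M x
  | 0, .selected _ _ _ _, _ => 0
  | m + 1, .selected M _ t _, x => W.value g (m / 2) (W.fire M t) x

theorem stateValue_zero_marking {M : Marking P} (hM : W.Reachable M) (x : P → WithBot ℕ) :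
    W.stateValue g 0 (.marking M hM) x = if M = W.final then g x else 0 := by
  rw [stateValue, Nat.zero_div, value_zero]

theorem tsum_stepProb_mul {M : Marking P} (hM : W.Reachable M) {C : Finset T}
    (hC : C ∈ W.conflictSets M) (f : W.State → ℝ≥0∞) (F : T → ℝ≥0∞)
    (hF : ∀ t ht, f (.selected M hM t ht) = F t) :
    ∑' s, W.stepProb M C s * f s = ∑ t, W.choiceProb C t * F t := by
  let i : {t // W.Enabled M t} → W.State := fun t => .selected M hM t.1 t.2
  have hi : Function.Injective i := by
    rintro ⟨t, ht⟩ ⟨u, hu⟩ h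
    injection h with _ h
    exact Subtype.ext h
  rw [← hi.tsum_eq, ← tsum_fintype (L := .unconditional T),
    ← (Subtype.val_injective (p := W.Enabled M)).tsum_eq]
  · refine tsum_congr fun t => ?_
    rw [hF, stepProb, if_pos rfl]
  · intro t ht
    simp only [Function.mem_support] at ht
    by_cases h : t ∈ C
    · exact ⟨⟨t, W.enabled_of_mem_conflictSets hC h⟩, rfl⟩
    · simp [W.choiceProb_of_notMem h] at ht
  · rintro (⟨M', hM'⟩ | ⟨M', hM', t, ht⟩) h
    · simp [stepProb] at h
    · by_cases hMM : M' = M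
      · subst hMM
        exact ⟨⟨t, ht⟩, rfl⟩
      · simp [stepProb, hMM] at h

/-- `stateValue` is preserved on average by every available distribution. -/
theorem tsum_mul_stateValue {q : W.State} {l : PMF W.State} (hl : l ∈ W.steps q) (m : ℕ)
    (x : P → WithBot ℕ) :
    ∑' s, l s * W.stateValue g m s (W.updState x s) = W.stateValue g (m + 1) q x := by
  rcases q with ⟨M, hM⟩ | ⟨M, hM, t, ht⟩
  · rcases hl with ⟨hdead, rfl⟩ | ⟨C, hC, hl⟩
    · rw [tsum_eq_single (.marking M hM) fun s hs => by simp [PMF.pure_apply, hs]]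
      simp [updState, State.transition?, stateValue, W.value_of_deadlock g hdead]
    · simp only [hl]
      cases m with
      | zero =>
        rw [W.tsum_stepProb_mul hM hC _ 0 fun t ht => rfl]
        obtain ⟨u, hu⟩ := W.nonempty_of_mem_conflictSets hC
        simp [stateValue, value_zero,
          W.ne_final_of_enabled (W.enabled_of_mem_conflictSets hC hu)]
      | succ m =>
        rw [W.tsum_stepProb_mul hM hC _
          (fun t => W.value g (m / 2) (W.fire M t) (W.upd x t)) fun t ht => rfl,
          stateValue, show (m + 1 + 1) / 2 = m / 2 + 1 by omega, W.value_succ g hM hC]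
  · obtain rfl : l = PMF.pure (.marking (W.fire M t) (W.reachable_fire hM ht)) := hl
    rw [tsum_eq_single (.marking (W.fire M t) (W.reachable_fire hM ht))
      fun s hs => by simp [PMF.pure_apply, hs]]
    simp [updState, State.transition?, stateValue]

end TPWN

/-! ### Integration over the paths of a decision process -/

namespace MDP

variable {Q : Type*} {D : MDP Q} [Finite Q] [MeasurableSpace Q] [MeasurableSingletonClass Q]
  (S : D.Scheduler)

instance : IsProbabilityMeasure S.prob := by
  unfold Scheduler.prob
  infer_instance

/-- The next state is distributed as the scheduler chooses, given the path so far. -/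
theorem Scheduler.lintegral_step (k : ℕ) (f : (Finset.Iic k → Q) → Q → ℝ≥0∞) :
    ∫⁻ π, f (Preorder.frestrictLe k π) (π (k + 1)) ∂S.prob =
      ∫⁻ π, ∑' s, S.choose k (Preorder.frestrictLe k π) s * f (Preorder.frestrictLe k π) s
        ∂S.prob := by
  have hf : Measurable (Function.uncurry f) := measurable_of_countable _
  have hmeas : Measurable fun π : ℕ → Q => (Preorder.frestrictLe (π := fun _ => Q) k π, π (k + 1)) :=
    by fun_prop
  calc ∫⁻ π, f (Preorder.frestrictLe k π) (π (k + 1)) ∂S.prob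
      = ∫⁻ z, Function.uncurry f z ∂(S.prob.map
          fun π => (Preorder.frestrictLe (π := fun _ => Q) k π, π (k + 1))) :=
        (lintegral_map hf hmeas).symm
    _ = ∫⁻ h, ∫⁻ s, f h s ∂(S.kernel k h) ∂(S.prob.map (Preorder.frestrictLe k)) := by
        rw [Scheduler.prob, ← Kernel.partialTraj_compProd_eq_map_traj (Nat.zero_le k),
          Measure.lintegral_compProd hf, Kernel.traj_map_frestrictLe_apply]
        rfl
    _ = ∫⁻ π, ∫⁻ s, f (Preorder.frestrictLe k π) s ∂(S.kernel k (Preorder.frestrictLe k π))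
          ∂S.prob :=
        lintegral_map (measurable_of_countable _) (by fun_prop)
    _ = _ := by
        refine lintegral_congr fun π => ?_
        rw [lintegral_countable']
        refine tsum_congr fun s => ?_
        rw [mul_comm]
        congr 1
        exact PMF.toMeasure_apply_singleton _ _ (measurableSet_singleton _)

theorem Scheduler.ae_zero_eq_init : ∀ᵐ π ∂S.prob, π 0 = D.init := by
  have h : S.prob.map (Preorder.frestrictLe 0) = Measure.dirac fun _ => D.init := by
    rw [Scheduler.prob, Kernel.traj_map_frestrictLe_apply, Kernel.partialTraj_self,
      Kernel.id_apply]
  have h2 : ∀ᵐ x ∂(S.prob.map (Preorder.frestrictLe 0)), x = fun _ => D.init := by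
    rw [h, ae_dirac_eq]
    rfl
  filter_upwards [ae_of_ae_map (by fun_prop) h2] with π hπ
  exact congrFun hπ ⟨0, by simp⟩

/-- Almost every path moves along transitions of positive probability. -/
theorem Scheduler.ae_exists_step :
    ∀ᵐ π ∂S.prob, ∀ k, ∃ l ∈ D.steps (π k), l (π (k + 1)) ≠ 0 := by
  classical
  refine ae_all_iff.2 fun k => ?_
  have h := S.lintegral_step k fun h s => if S.choose k h s = 0 then 1 else 0
  have h0 : ∀ π : ℕ → Q, ∑' s, S.choose k (Preorder.frestrictLe k π) s *
      (if S.choose k (Preorder.frestrictLe k π) s = 0 then 1 else 0 : ℝ≥0∞) = 0 := by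
    intro π
    refine ENNReal.tsum_eq_zero.2 fun s => ?_
    split_ifs with hs <;> simp [hs]
  simp only [h0, lintegral_zero] at h
  have hmeas : Measurable fun π : ℕ → Q =>
      (if S.choose k (Preorder.frestrictLe k π) (π (k + 1)) = 0 then 1 else 0 : ℝ≥0∞) := by
    have h1 : Measurable fun z : (Finset.Iic k → Q) × Q =>
        (if S.choose k z.1 z.2 = 0 then 1 else 0 : ℝ≥0∞) := measurable_of_countable _
    exact h1.comp (f := fun π : ℕ → Q =>
      (Preorder.frestrictLe (π := fun _ => Q) k π, π (k + 1))) (by fun_prop)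
  filter_upwards [(lintegral_eq_zero_iff hmeas).1 h] with π hπ
  refine ⟨_, S.choose_mem k (Preorder.frestrictLe k π), fun h => ?_⟩
  simp [h] at hπ

end MDP

namespace TPWN

variable {P T : Type*} [Fintype P] [DecidableEq P] [Fintype T] (W : TPWN P T)
  [DecidableEq T]

/-! ### The expected time under a scheduler -/

variable (g : (P → WithBot ℕ) → ℝ≥0∞)

/-- The value of the state reached after `k` steps has an expectation that does not depend on the
scheduler: it equals the value of the initial state over the whole horizon. -/
theorem lintegral_stateValue (S : W.mdp.Scheduler) (k m : ℕ) :
    ∫⁻ π, W.stateValue g m (π k) (W.timestamp (W.pathSeq π k)) ∂S.prob =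
      W.stateValue g (m + k) W.mdp.init (W.timestamp []) := by
  induction k generalizing m with
  | zero =>
    have h : ∀ᵐ π ∂S.prob, W.stateValue g m (π 0) (W.timestamp (W.pathSeq π 0)) =
        W.stateValue g m W.mdp.init (W.timestamp []) := by
      filter_upwards [S.ae_zero_eq_init] with π hπ
      have : W.pathSeq π 0 = [] := by
        simp only [pathSeq, zero_add, List.range_one, List.filterMap_cons, hπ, mdp,
          State.transition?, List.filterMap_nil]
      rw [this, hπ]
    rw [lintegral_congr_ae h, lintegral_const, measure_univ, mul_one, add_zero]
  | succ k ih =>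
    have h := S.lintegral_step k fun h s =>
      W.stateValue g m s (W.updState (W.timestamp (W.pathSeq (W.extendPath h) k)) s)
    simp only [pathSeq_extendPath, ← timestamp_pathSeq_succ] at h
    rw [h, show m + (k + 1) = m + 1 + k by omega, ← ih]
    exact lintegral_congr fun π =>
      W.tsum_mul_stateValue g (S.choose_mem k (Preorder.frestrictLe k π)) m _

/-- The value of `g` at the timestamps after `n` steps if the path is then in the final marking,
and `0` otherwise. -/
noncomputable def arrival (n : ℕ) (π : ℕ → W.State) : ℝ≥0∞ :=
  W.stateValue g 0 (π n) (W.timestamp (W.pathSeq π n))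

/-- Two steps of the decision process make one transition, whence `n / 2`. -/
theorem lintegral_arrival (S : W.mdp.Scheduler) (n : ℕ) :
    ∫⁻ π, W.arrival g n π ∂S.prob = W.value g (n / 2) W.initial (W.timestamp []) := by
  simp only [arrival]
  rw [lintegral_stateValue, zero_add, mdp, stateValue]

theorem measurable_arrival (n : ℕ) : Measurable (W.arrival g n) := by
  have h : Measurable fun h : Finset.Iic n → W.State => W.arrival g n (W.extendPath h) :=
    measurable_of_countable _
  convert h.comp (Preorder.measurable_frestrictLe (X := fun _ => W.State) n) using 1
  funext π
  simp [arrival, pathSeq_extendPath, extendPath]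

theorem arrival_of_isMarking {n : ℕ} {π : ℕ → W.State} (h : (π n).IsMarking W.final) :
    W.arrival g n π = g (W.timestamp (W.pathSeq π n)) := by
  rw [arrival]
  rcases hq : π n with ⟨M, hM⟩ | ⟨M, hM, t, ht⟩
  · rw [hq] at h
    rw [stateValue_zero_marking]
    exact if_pos h
  · rw [hq] at h
    exact h.elim

theorem arrival_of_not_isMarking {n : ℕ} {π : ℕ → W.State} (h : ¬ (π n).IsMarking W.final) :
    W.arrival g n π = 0 := by
  rw [arrival]
  rcases hq : π n with ⟨M, hM⟩ | ⟨M, hM, t, ht⟩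
  · rw [hq] at h
    rw [stateValue_zero_marking]
    exact if_neg h
  · rfl

theorem ae_final_absorbing (S : W.mdp.Scheduler) :
    ∀ᵐ π ∂S.prob, ∀ k, (π k).IsMarking W.final → π (k + 1) = π k := by
  filter_upwards [S.ae_exists_step] with π hπ k hk
  obtain ⟨l, hl, hpos⟩ := hπ k
  rcases hq : π k with ⟨M, hM⟩ | ⟨M, hM, t, ht⟩
  · rw [hq] at hk hl
    obtain rfl : M = W.final := hk
    rcases hl with ⟨_, rfl⟩ | ⟨C, ⟨t, ht, _⟩, _⟩
    · by_contra hne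
      exact hpos (by simp [PMF.pure_apply, hne])
    · exact (W.not_enabled_final t ht).elim
  · rw [hq] at hk
    exact hk.elim

theorem monotone_arrival {π : ℕ → W.State}
    (hπ : ∀ k, (π k).IsMarking W.final → π (k + 1) = π k) :
    Monotone fun n => W.arrival g n π := by
  intro m n hmn
  by_cases hm : (π m).IsMarking W.final
  · obtain ⟨hn, heq⟩ := W.pathSeq_of_final_absorbing hπ hmn hm
    simp only [W.arrival_of_isMarking g hm, W.arrival_of_isMarking g hn, heq, le_refl]
  · simp only [W.arrival_of_not_isMarking g hm, zero_le]

/-- If the final marking is reached, the second summand vanishes; if not, the first one does. -/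
theorem timeTo_eq_arrival {π : ℕ → W.State}
    (hπ : ∀ k, (π k).IsMarking W.final → π (k + 1) = π k) :
    W.timeTo W.final π =
      (⨆ n, W.arrival maxTime n π) + ∞ * (1 - ⨆ n, W.arrival (fun _ => 1) n π) := by
  classical
  by_cases h : ∃ n, (π n).IsMarking W.final
  · have hsup : ∀ g : (P → WithBot ℕ) → ℝ≥0∞,
        ⨆ n, W.arrival g n π = g (W.timestamp (W.pathSeq π (Nat.find h))) := by
      intro g
      refine le_antisymm (iSup_le fun n => ?_) (le_iSup_of_le (Nat.find h)
        (W.arrival_of_isMarking g (Nat.find_spec h)).ge)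
      by_cases hn : (π n).IsMarking W.final
      · rw [W.arrival_of_isMarking g hn,
          (W.pathSeq_of_final_absorbing hπ (Nat.find_min' h hn) (Nat.find_spec h)).2]
      · simp [W.arrival_of_not_isMarking g hn]
    rw [hsup, hsup, timeTo, dif_pos h, tsub_self, mul_zero, add_zero, maxTime, time]
  · have h0 : ∀ n, W.arrival (fun _ => 1) n π = 0 := fun n =>
      W.arrival_of_not_isMarking _ fun hn => h ⟨n, hn⟩
    rw [timeTo, dif_neg h]
    simp [h0]

/-- The common expected time of all schedulers: the supremum over `n` of the contributions of the
runs with at most `n` transitions, plus `∞` if the final marking is not reached almost surely. -/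
noncomputable def limitTime : ℝ≥0∞ :=
  (⨆ n, W.value maxTime n W.initial (W.timestamp [])) +
    ∞ * (1 - ⨆ n, W.value (fun _ => 1) n W.initial (W.timestamp []))

theorem lintegral_iSup_arrival (S : W.mdp.Scheduler) :
    ∫⁻ π, ⨆ n, W.arrival g n π ∂S.prob =
      ⨆ n, W.value g n W.initial (W.timestamp []) := by
  rw [lintegral_iSup' (fun n => (W.measurable_arrival g n).aemeasurable)]
  · simp only [lintegral_arrival]
    exact Function.Surjective.iSup_comp (f := fun n => n / 2) (fun n => ⟨2 * n, by simp⟩)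
      fun n => W.value g n W.initial (W.timestamp [])
  · filter_upwards [W.ae_final_absorbing S] with π hπ
    exact W.monotone_arrival g hπ

theorem expectedTime_eq_limitTime (S : W.mdp.Scheduler) : W.expectedTime S = W.limitTime := by
  have hmeas : ∀ g, Measurable fun π => ⨆ n, W.arrival g n π := fun g =>
    Measurable.iSup fun n => W.measurable_arrival g n
  have hle : ∀ π, ⨆ n, W.arrival (fun _ => 1) n π ≤ 1 := fun π => iSup_le fun n => by
    by_cases hn : (π n).IsMarking W.final
    · rw [W.arrival_of_isMarking _ hn]
    · simp [W.arrival_of_not_isMarking _ hn]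
  have hfin : ∫⁻ π, ⨆ n, W.arrival (fun _ => 1) n π ∂S.prob ≠ ∞ :=
    ((lintegral_mono hle).trans_lt (by simp)).ne
  calc W.expectedTime S
      = ∫⁻ π, (⨆ n, W.arrival maxTime n π) +
          ∞ * (1 - ⨆ n, W.arrival (fun _ => 1) n π) ∂S.prob := by
        refine lintegral_congr_ae ?_
        filter_upwards [W.ae_final_absorbing S] with π hπ
        exact W.timeTo_eq_arrival hπ
    _ = (∫⁻ π, ⨆ n, W.arrival maxTime n π ∂S.prob) +
          ∞ * (1 - ∫⁻ π, ⨆ n, W.arrival (fun _ => 1) n π ∂S.prob) := by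
        rw [lintegral_add_left (hmeas _), lintegral_const_mul _ ((hmeas _).const_sub 1),
          lintegral_sub (hmeas _) hfin (.of_forall hle), lintegral_one, measure_univ]
    _ = W.limitTime := by
        rw [lintegral_iSup_arrival, lintegral_iSup_arrival, limitTime]

end TPWN

namespace TPWN

variable {P T : Type*} [Fintype P] [DecidableEq P] [Fintype T] (W : TPWN P T)

/-! ### Finite expected time and soundness -/

theorem maxTime_upd_le (x : P → WithBot ℕ) (t : T) :
    maxTime (W.upd x t) ≤ maxTime x + W.dur t := by
  have h : Finset.univ.sup (W.upd x t) ≤ Finset.univ.sup x + (W.dur t : WithBot ℕ) := by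
    refine Finset.sup_le fun p _ => ?_
    rw [upd]
    split_ifs
    · gcongr
      exact Finset.subset_univ _
    · exact bot_le
    · exact (Finset.le_sup (Finset.mem_univ p)).trans
        (le_add_of_nonneg_right (Nat.cast_nonneg (α := WithBot ℕ) _))
  rw [maxTime, maxTime]
  norm_cast
  revert h
  generalize Finset.univ.sup (W.upd x t) = a
  generalize Finset.univ.sup x = b
  intro h
  cases a with
  | bot => simp
  | coe a =>
    cases b with
    | bot => simp at h
    | coe b =>
      simp only [WithBot.unbotD_coe]
      change a ≤ b + W.dur t
      have h' : (a : WithBot ℕ) ≤ WithBot.some (b + W.dur t) := h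
      exact WithBot.coe_le_coe.1 h'

/-- In a sound net, the distance to the final marking decreases along some transition. -/
theorem exists_dist (hW : W.Sound) : ∃ d : Marking P → ℕ, ∀ M, W.Reachable M → M ≠ W.final →
    ∃ t, W.Enabled M t ∧ d (W.fire M t) + 1 ≤ d M := by
  refine ⟨fun M => sInf {n | ∃ σ : List T, σ.length = n ∧ W.FiringSeq M σ W.final},
    fun M hM hne => ?_⟩
  have hex : {n | ∃ σ : List T, σ.length = n ∧ W.FiringSeq M σ W.final}.Nonempty :=
    let ⟨σ, hσ⟩ := hW M hM
    ⟨_, σ, rfl, hσ⟩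
  obtain ⟨σ, hlen, hσ⟩ := Nat.sInf_mem hex
  cases hσ with
  | nil => exact (hne rfl).elim
  | cons _ t σ _ ht hσ =>
    refine ⟨t, ht, ?_⟩
    simp only at hlen ⊢
    rw [← hlen, List.length_cons]
    exact Nat.succ_le_succ (Nat.sInf_le ⟨σ, rfl, hσ⟩)

theorem exists_bound_of_reachable (d : Marking P → ℕ) :
    ∃ D, ∀ M, W.Reachable M → d M ≤ D := by
  let f : W.State → ℕ := fun q =>
    match q with
    | .marking M _ => d M
    | .selected _ _ _ _ => 0
  obtain ⟨D, hD⟩ := (Set.finite_range f).bddAbove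
  exact ⟨D, fun M hM => hD ⟨.marking M hM, rfl⟩⟩

/-- In a sound net, some bounded function grows by any given factor along some transition. With `d`
the distance to the final marking and `D` its maximum, it is `e (D - d)` for a sequence `e` that
grows fast enough. -/
theorem exists_growth (hW : W.Sound) (K : ℕ) :
    ∃ (b : Marking P → ℕ) (E : ℕ), (∀ M, b M ≤ E) ∧ ∀ M, W.Reachable M → M ≠ W.final →
      ∃ t, W.Enabled M t ∧ K * (b M + 1) ≤ b (W.fire M t) := by
  obtain ⟨d, hd⟩ := W.exists_dist hW
  obtain ⟨D, hD⟩ := W.exists_bound_of_reachable d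
  let e : ℕ → ℕ := fun n => Nat.rec 0 (fun _ a => a + K * (a + 1)) n
  have he : ∀ n, e (n + 1) = e n + K * (e n + 1) := fun n => rfl
  have hmono : Monotone e := monotone_nat_of_le_succ fun n => by rw [he]; omega
  refine ⟨fun M => e (D - d M), e D, fun M => hmono (Nat.sub_le _ _), fun M hM hne => ?_⟩
  obtain ⟨t, ht, hdt⟩ := hd M hM hne
  have h2 : D - d M + 1 ≤ D - d (W.fire M t) := by
    have := hD M hM
    omega
  have h3 := hmono h2
  rw [he] at h3
  exact ⟨t, ht, by dsimp only; omega⟩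

variable [DecidableEq T]

theorem exists_natCast_mul_choiceProb :
    ∃ K : ℕ, ∀ (C : Finset T), ∀ t ∈ C, 1 ≤ (K : ℝ≥0∞) * W.choiceProb C t := by
  have h : ∀ z : Finset T × T, ∃ k : ℕ, z.2 ∈ z.1 → 1 ≤ (k : ℝ≥0∞) * W.choiceProb z.1 z.2 := by
    intro z
    by_cases hz : z.2 ∈ z.1
    · obtain ⟨k, hk⟩ := ENNReal.exists_nat_mul_gt (W.choiceProb_ne_zero hz) ENNReal.one_ne_top
      exact ⟨k, fun _ => hk.le⟩
    · exact ⟨0, fun h => (hz h).elim⟩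
  choose k hk using h
  refine ⟨∑ z, k z, fun C t ht => (hk (C, t) ht).trans ?_⟩
  gcongr
  exact Finset.single_le_sum (f := k) (fun _ _ => Nat.zero_le _) (Finset.mem_univ (C, t))

/-- While the final marking is not reached, one more transition lowers `h` by at least `1` on
average, if the conflict set is chosen suitably. -/
def IsDrift (h : Marking P → ℕ) : Prop :=
  ∀ M, W.Reachable M → M ≠ W.final → ∃ C ∈ W.conflictSets M,
    ∑ t, W.choiceProb C t * (h (W.fire M t) : ℝ≥0∞) + 1 ≤ h M

/-- With `b` bounded by `E` as in `exists_growth`, the drift function is `E - b`: if `1 / K` is a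
lower bound for the probabilities of choices, then the growth of `b` along one transition, which
has probability at least `1 / K`, outweighs every other outcome. -/
theorem exists_isDrift (hW : W.Sound) : ∃ h, W.IsDrift h := by
  obtain ⟨K, hK⟩ := W.exists_natCast_mul_choiceProb
  obtain ⟨b, E, hbE, hb⟩ := W.exists_growth hW K
  refine ⟨fun M => E - b M, fun M hM hne => ?_⟩
  obtain ⟨t, ht, hbt⟩ := hb M hM hne
  have htC : t ∈ W.conflictSet t M := W.mem_conflictSet.2 (W.inConflict_self ht)
  refine ⟨W.conflictSet t M, W.conflictSet_mem_conflictSets ht, ?_⟩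
  set C := W.conflictSet t M
  have hh : ∀ M', ((E - b M' : ℕ) : ℝ≥0∞) + (b M' : ℝ≥0∞) = E := fun M' => by
    rw [← Nat.cast_add, Nat.sub_add_cancel (hbE M')]
  have hgain : (1 : ℝ≥0∞) + (b M : ℝ≥0∞) ≤ W.choiceProb C t * (b (W.fire M t) : ℝ≥0∞) :=
    calc (1 : ℝ≥0∞) + (b M : ℝ≥0∞) = 1 * (b M + 1) := by rw [one_mul, add_comm]
      _ ≤ K * W.choiceProb C t * (b M + 1) := by
          gcongr
          exact hK C t htC
      _ = W.choiceProb C t * ((K * (b M + 1) : ℕ) : ℝ≥0∞) := by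
          push_cast
          ring
      _ ≤ _ := by gcongr
  rw [← ENNReal.add_le_add_iff_right (ENNReal.natCast_ne_top (b M)), hh]
  calc ∑ u, W.choiceProb C u * ((E - b (W.fire M u) : ℕ) : ℝ≥0∞) + 1 + (b M : ℝ≥0∞)
      ≤ ∑ u, W.choiceProb C u * ((E - b (W.fire M u) : ℕ) : ℝ≥0∞) +
          W.choiceProb C t * (b (W.fire M t) : ℝ≥0∞) := by
        rw [add_assoc]
        gcongr
    _ ≤ ∑ u, W.choiceProb C u * ((E - b (W.fire M u) : ℕ) : ℝ≥0∞) +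
          ∑ u, W.choiceProb C u * (b (W.fire M u) : ℝ≥0∞) := by
        gcongr
        exact Finset.single_le_sum (f := fun u => W.choiceProb C u * (b (W.fire M u) : ℝ≥0∞))
          (fun _ _ => zero_le) (Finset.mem_univ t)
    _ = ∑ u, W.choiceProb C u * (E : ℝ≥0∞) := by
        rw [← Finset.sum_add_distrib]
        exact Finset.sum_congr rfl fun u _ => by rw [← mul_add, hh]
    _ = E := W.sum_choiceProb_mul_const ⟨t, htC⟩ _

theorem value_maxTime_le {h : Marking P → ℕ} (hh : W.IsDrift h) (n : ℕ) {M : Marking P}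
    (hM : W.Reachable M) (x : P → WithBot ℕ) :
    W.value maxTime n M x ≤ maxTime x + ((∑ t, W.dur t : ℕ) : ℝ≥0∞) * h M := by
  induction n generalizing M x with
  | zero =>
    rw [value_zero]
    split_ifs
    · exact le_self_add
    · exact zero_le
  | succ n ih =>
    by_cases hne : M = W.final
    · rw [hne, value_final]
      exact le_self_add
    obtain ⟨C, hC, hdrift⟩ := hh M hM hne
    have hCne := W.nonempty_of_mem_conflictSets hC
    set c : ℝ≥0∞ := ((∑ t, W.dur t : ℕ) : ℝ≥0∞) with hc
    have hdur : ∀ t, (W.dur t : ℝ≥0∞) ≤ c := fun t => by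
      rw [hc]
      gcongr
      exact Finset.single_le_sum (fun _ _ => Nat.zero_le _) (Finset.mem_univ t)
    calc W.value maxTime (n + 1) M x
        = ∑ t, W.choiceProb C t * W.value maxTime n (W.fire M t) (W.upd x t) :=
          W.value_succ maxTime hM hC n x
      _ ≤ ∑ t, W.choiceProb C t * (maxTime x + c + c * h (W.fire M t)) := by
          refine W.sum_choiceProb_mul_le fun t ht => ?_
          refine (ih (W.reachable_fire hM (W.enabled_of_mem_conflictSets hC ht)) _).trans ?_
          gcongr
          exact (W.maxTime_upd_le x t).trans (by gcongr; exact hdur t)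
      _ = maxTime x + c * (∑ t, W.choiceProb C t * (h (W.fire M t) : ℝ≥0∞) + 1) := by
          simp only [mul_add, Finset.sum_add_distrib, W.sum_choiceProb_mul_const hCne,
            mul_left_comm _ c, ← Finset.mul_sum]
          ring
      _ ≤ _ := by gcongr

/-- The process misses the final marking within `n` transitions with probability at most
`h M / n`. -/
theorem natCast_le_drift_add {h : Marking P → ℕ} (hh : W.IsDrift h) (n : ℕ) {M : Marking P}
    (hM : W.Reachable M)
    (x : P → WithBot ℕ) : (n : ℝ≥0∞) ≤ h M + n * W.value (fun _ => 1) n M x := by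
  induction n generalizing M x with
  | zero => simp
  | succ n ih =>
    by_cases hne : M = W.final
    · rw [hne, value_final, mul_one]
      exact le_add_self
    obtain ⟨C, hC, hdrift⟩ := hh M hM hne
    have hCne := W.nonempty_of_mem_conflictSets hC
    set v : T → ℝ≥0∞ := fun t => W.value (fun _ => 1) n (W.fire M t) (W.upd x t) with hv
    calc ((n + 1 : ℕ) : ℝ≥0∞) = ∑ t, W.choiceProb C t * (n : ℝ≥0∞) + 1 := by
          rw [W.sum_choiceProb_mul_const hCne, Nat.cast_succ]
      _ ≤ ∑ t, W.choiceProb C t * (h (W.fire M t) + n * v t) + 1 := by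
          gcongr ?_ + 1
          exact W.sum_choiceProb_mul_le fun t ht =>
            ih (W.reachable_fire hM (W.enabled_of_mem_conflictSets hC ht)) _
      _ = (∑ t, W.choiceProb C t * (h (W.fire M t) : ℝ≥0∞) + 1) +
            n * ∑ t, W.choiceProb C t * v t := by
          simp only [mul_add, Finset.sum_add_distrib, mul_left_comm _ (n : ℝ≥0∞),
            ← Finset.mul_sum]
          ring
      _ ≤ h M + (n + 1 : ℕ) * W.value (fun _ => 1) (n + 1) M x := by
          rw [W.value_succ _ hM hC]
          gcongr
          exact Nat.le_succ n

theorem limitTime_lt_top (hW : W.Sound) : W.limitTime < ∞ := by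
  obtain ⟨h, hh⟩ := W.exists_isDrift hW
  set s := ⨆ n, W.value (fun _ => 1) n W.initial (W.timestamp []) with hs
  have hs1 : 1 ≤ s := by
    by_contra! hlt
    obtain ⟨n, hn⟩ := ENNReal.exists_nat_mul_gt (tsub_pos_of_lt hlt).ne'
      (ENNReal.natCast_ne_top (h W.initial))
    have hle : (n : ℝ≥0∞) ≤ h W.initial + n * s := by
      refine (W.natCast_le_drift_add hh n W.reachable_initial (W.timestamp [])).trans ?_
      gcongr
      exact le_iSup (fun n => W.value (fun _ => 1) n W.initial (W.timestamp [])) n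
    have hfin : (n : ℝ≥0∞) * s ≠ ∞ :=
      ENNReal.mul_ne_top (ENNReal.natCast_ne_top n) hlt.ne_top
    refine hle.not_gt ?_
    calc (h W.initial : ℝ≥0∞) + n * s < n * (1 - s) + n * s :=
          ENNReal.add_lt_add_right hfin hn
      _ = n := by rw [← mul_add, tsub_add_cancel_of_le hlt.le, mul_one]
  rw [limitTime, ← hs, tsub_eq_zero_of_le hs1, mul_zero, add_zero]
  refine (iSup_le fun n => W.value_maxTime_le hh n W.reachable_initial (W.timestamp [])).trans_lt ?_
  rw [maxTime]
  norm_cast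
  exact ENNReal.natCast_lt_top _

theorem value_eq_zero_of_forall_not_firingSeq (g : (P → WithBot ℕ) → ℝ≥0∞) (n : ℕ)
    {M : Marking P} (hM : W.Reachable M) (hbad : ∀ σ, ¬ W.FiringSeq M σ W.final)
    (x : P → WithBot ℕ) : W.value g n M x = 0 := by
  have hne : M ≠ W.final := fun h => hbad [] (h ▸ .nil _)
  induction n generalizing M x with
  | zero => rw [value_zero, if_neg hne]
  | succ n ih =>
    by_cases hdead : ∀ t, ¬ W.Enabled M t
    · rw [W.value_of_deadlock g hdead, if_neg hne]
    push Not at hdead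
    obtain ⟨t, ht⟩ := hdead
    have hC := W.conflictSet_mem_conflictSets ht
    rw [W.value_succ g hM hC]
    refine Finset.sum_eq_zero fun u _ => ?_
    by_cases hu : u ∈ W.conflictSet t M
    · have hu' := W.enabled_of_mem_conflictSets hC hu
      have hbad' : ∀ σ, ¬ W.FiringSeq (W.fire M u) σ W.final := fun σ hσ =>
        hbad (u :: σ) (.cons _ _ _ _ hu' hσ)
      rw [ih (W.reachable_fire hM hu') hbad' _ fun h => hbad' [] (h ▸ .nil _), mul_zero]
    · rw [W.choiceProb_of_notMem hu, zero_mul]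

theorem value_one_le_one (n : ℕ) {M : Marking P} (hM : W.Reachable M) (x : P → WithBot ℕ) :
    W.value (fun _ => 1) n M x ≤ 1 := by
  induction n generalizing M x with
  | zero =>
    rw [value_zero]
    split_ifs <;> simp
  | succ n ih =>
    by_cases hdead : ∀ t, ¬ W.Enabled M t
    · rw [W.value_of_deadlock _ hdead]
      split_ifs <;> simp
    push Not at hdead
    obtain ⟨t, ht⟩ := hdead
    have hC := W.conflictSet_mem_conflictSets ht
    rw [W.value_succ _ hM hC]
    calc _ ≤ ∑ u, W.choiceProb (W.conflictSet t M) u * 1 :=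
          W.sum_choiceProb_mul_le fun u hu =>
            ih (W.reachable_fire hM (W.enabled_of_mem_conflictSets hC hu)) _
      _ = 1 := W.sum_choiceProb_mul_const (W.nonempty_of_mem_conflictSets hC) 1

/-- If a marking that cannot reach the final one can be reached from `M`, then the final marking
is missed with a positive probability: by choosing the conflict sets of the transitions that lead
to the bad marking. -/
theorem exists_gap {M M' : Marking P} {σ : List T} (hσ : W.FiringSeq M σ M')
    (hM : W.Reachable M) (hbad : ∀ ρ, ¬ W.FiringSeq M' ρ W.final) :
    ∃ ε : ℝ≥0∞, ε ≠ 0 ∧ ∀ n x, W.value (fun _ => 1) n M x + ε ≤ 1 := by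
  induction hσ with
  | nil M =>
    refine ⟨1, one_ne_zero, fun n x => ?_⟩
    rw [W.value_eq_zero_of_forall_not_firingSeq _ n hM hbad, zero_add]
  | cons M t σ M' ht _ ih =>
    obtain ⟨ε, hε, hle⟩ := ih (W.reachable_fire hM ht) hbad
    have hC := W.conflictSet_mem_conflictSets ht
    have htC : t ∈ W.conflictSet t M := W.mem_conflictSet.2 (W.inConflict_self ht)
    set C := W.conflictSet t M
    have key : ∀ v : T → ℝ≥0∞, (∀ u ∈ C, v u ≤ 1) → v t + ε ≤ 1 →
        ∑ u, W.choiceProb C u * v u + W.choiceProb C t * ε ≤ 1 := by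
      intro v hv hvt
      calc ∑ u, W.choiceProb C u * v u + W.choiceProb C t * ε
          = ∑ u, W.choiceProb C u * (v u + if u = t then ε else 0) := by
            simp [mul_add, Finset.sum_add_distrib]
        _ ≤ ∑ u, W.choiceProb C u * 1 := by
            refine W.sum_choiceProb_mul_le fun u hu => ?_
            split_ifs with h
            · rwa [h]
            · rw [add_zero]
              exact hv u hu
        _ = 1 := W.sum_choiceProb_mul_const ⟨t, htC⟩ 1
    refine ⟨W.choiceProb C t * ε, mul_ne_zero (W.choiceProb_ne_zero htC) hε, fun n x => ?_⟩
    cases n with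
    | zero =>
      rw [value_zero, if_neg (W.ne_final_of_enabled ht)]
      simpa using key (fun _ => 0) (fun _ _ => zero_le)
        ((zero_add ε).le.trans (le_add_self.trans (hle 0 x)))
    | succ n =>
      rw [W.value_succ _ hM hC]
      exact key _ (fun u hu => W.value_one_le_one n
        (W.reachable_fire hM (W.enabled_of_mem_conflictSets hC hu)) _) (hle n _)

theorem limitTime_eq_top (hW : ¬ W.Sound) : W.limitTime = ∞ := by
  rw [Net.Sound] at hW
  push Not at hW
  obtain ⟨M, ⟨σ, hσ⟩, hbad⟩ := hW
  obtain ⟨ε, hε, hle⟩ := W.exists_gap hσ W.reachable_initial hbad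
  set s := ⨆ n, W.value (fun _ => 1) n W.initial (W.timestamp []) with hs
  have hsε : s + ε ≤ 1 := by
    rw [hs, ENNReal.iSup_add]
    exact iSup_le fun n => hle n _
  have hpos : 1 - s ≠ 0 := by
    intro h
    have h1 : s + ε ≤ s + 0 := by
      rw [add_zero]
      exact hsε.trans (tsub_eq_zero_iff_le.1 h)
    have hfin : s ≠ ∞ := ((le_self_add.trans hsε).trans_lt ENNReal.one_lt_top).ne
    exact hε (le_zero_iff.1 ((ENNReal.add_le_add_iff_left hfin).1 h1))
  rw [limitTime, ← hs, ENNReal.top_mul hpos, add_top]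

end TPWN

theorem theorem1 {P T : Type*} [Fintype P] [DecidableEq P] [Fintype T]
    [DecidableEq T] (W : TPWN P T) :
    ∃ ET : ℝ≥0∞,
      (∀ S : W.mdp.Scheduler, W.expectedTime S = ET) ∧ (ET < ∞ ↔ W.Sound) :=
  ⟨W.limitTime, W.expectedTime_eq_limitTime,
    fun h => by_contra fun hW => h.ne (W.limitTime_eq_top hW), W.limitTime_lt_top⟩
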